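/- Let $X$ be an arbitrary topological space. An étale groupoid over $X$ is a topological groupoid $\mathcal G$ (structure maps $s,t,i,\mathrm{inv},\mathrm{comp}$ continuous) whose space of objects is $X$ and whose source and target maps $s,t$ are local homeomorphisms. An isomorphism of étale groupoids over $X$ is a homeomorphism of the spaces of arrows that respects $s$, $t$ and composition and is the identity on $X$. Let $X_{top}$ be the poset of open subsets of $X$, and let $Homeo^l_X$ be the category whose objects are the open subsets of $X$ and whose morphisms $U\to V$ are the local homeomorphisms $U\to V$. Consider triples consisting of a small category $\mathcal C$ whose objects are the open subsets of $X$, an embedding functor $X_{top}\subset\mathcal C$ and a functor $\mathcal C\to Homeo^l_X$, $f\mapsto\bar f$, both being the identity on objects, whose composite is the inclusion $X_{top}\subset Homeo^l_X$. Restriction along inclusions makes $\mathcal C(-,V)$ a presheaf on $X$ for each open $V$. For $x\in X$ let $\mathcal C_x(V)=\varinjlim_{U\ni x}\mathcal C(U,V)$, and for $x,y\in X$ let $\mathcal C^\star(x,y)=\{f_x\in\mathcal C_x(X)\mid \bar f(x)=y\}$. Such a triple is a pseudogroup sheaf on $X$ if (a) for all $x\in X$ and all open $V\subset X$, the natural map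 $\mathcal C_x(V)\to\mathcal C_x(X)$ is a bijection onto $\{f_x\mid\bar f(x)\in V\}=\coprod_{y\in V}\mathcal C^\star(x,y)$ (so that $\mathcal C^\star$ is a category with set of objects $X$, under the composition $g_y\circ f_x=(g\circ f)_x$, where $g\in\mathcal C(V,X)$ and the representative $f$ of $f_x$ is taken in some $\mathcal C(U,V)$); (b) the category $\mathcal C^\star$ is a groupoid; (c) $\mathcal C(-,V)$ is a sheaf for each open $V\subset X$. An isomorphism of pseudogroup sheaves is an isomorphism of categories that is the identity on objects and commutes with the functors from $X_{top}$ and to $Homeo^l_X$. Theorem. For every étale groupoid $\mathcal G$ over $X$, the sets $\hat{\mathcal G}(U,V)=\{f:U\to t^{-1}(V)\text{ continuous}\mid s\circ f=\mathrm{id}\}$, with composition $(g\circ f)(x)=g(t(f(x)))\cdot f(x)$, the inclusions $U\subset V$ being sent to $i|_U$, and $\bar f=t\circ f$, form a pseudogroup sheaf on $X$. For every pseudogroup sheaf $\mathcal C$ on $X$, the groupoid $\mathcal C^\star$, whose set of arrows $\coprod_x\mathcal C_x(X)$ carries the topology of the étale space of $\mathcal C(-,X)$, is an étale groupoid over $X$.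 The assignments $\mathcal G\mapsto\hat{\mathcal G}$ and $\mathcal C\mapsto\mathcal C^\star$ induce mutually inverse bijections between the isomorphism classes of étale groupoids over $X$ and the isomorphism classes of pseudogroup sheaves on $X$. -/

import Mathlib

open CategoryTheory TopologicalSpace Opposite

universe u

/-- Local homeomorphisms from `U` to `V`: the morphisms of the category `Homeo^l_X`, whose objects
are the open subsets of `X`. -/
@[ext]
structure LocHomeo {X : Type u} [TopologicalSpace X] (U V : Opens X) where
  toFun : U → V
  isLocalHomeomorph : IsLocalHomeomorph toFun

namespace LocHomeo

variable {X : Type u} [TopologicalSpace X]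

/-- The identity of `U` in `Homeo^l_X`. -/
def id (U : Opens X) : LocHomeo U U := ⟨fun x => x, (Homeomorph.refl U).isLocalHomeomorph⟩

/-- Composition in `Homeo^l_X`. -/
def comp {U V W : Opens X} (g : LocHomeo V W) (f : LocHomeo U V) : LocHomeo U W :=
  ⟨g.1 ∘ f.1, g.2.comp f.2⟩

/-- The inclusion of `U` in `V`, seen in `Homeo^l_X`. -/
def incl {U V : Opens X} (h : U ≤ V) : LocHomeo U V :=
  ⟨Set.inclusion h, (Opens.isOpenEmbedding_of_le h).isLocalHomeomorph⟩

end LocHomeo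

/-- A triple consisting of a small category `C`, an embedding functor `X_top ⊂ C` and a functor
`C → Homeo^l_X`, such that `C` has the open subsets of `X` as its objects, both functors are the
identity on objects, and the composite `X_top ⊂ C → Homeo^l_X` is the inclusion. -/
structure PseudogroupTriple (X : Type u) [TopologicalSpace X] where
  /-- The set `C(U, V)`. -/
  Hom : Opens X → Opens X → Type u
  id : ∀ U : Opens X, Hom U U
  comp : ∀ {U V W : Opens X}, Hom V W → Hom U V → Hom U W
  id_comp : ∀ {U V : Opens X} (f : Hom U V), comp (id V) f = f
  comp_id : ∀ {U V : Opens X} (f : Hom U V), comp f (id U) = f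
  assoc : ∀ {U V W Z : Opens X} (h : Hom W Z) (g : Hom V W) (f : Hom U V),
    comp (comp h g) f = comp h (comp g f)
  /-- The functor `X_top ⊂ C`. -/
  incl : ∀ {U V : Opens X}, U ≤ V → Hom U V
  incl_refl : ∀ U : Opens X, incl (le_refl U) = id U
  incl_trans : ∀ {U V W : Opens X} (h : U ≤ V) (k : V ≤ W),
    incl (h.trans k) = comp (incl k) (incl h)
  /-- The functor `f ↦ f̄` from `C` to `Homeo^l_X`. -/
  under : ∀ {U V : Opens X}, Hom U V → LocHomeo U V
  under_id : ∀ U : Opens X, under (id U) = LocHomeo.id U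
  under_comp : ∀ {U V W : Opens X} (g : Hom V W) (f : Hom U V),
    under (comp g f) = LocHomeo.comp (under g) (under f)
  under_incl : ∀ {U V : Opens X} (h : U ≤ V), under (incl h) = LocHomeo.incl h

namespace PseudogroupTriple

variable {X : Type u} [TopologicalSpace X] (C : PseudogroupTriple X)

/-- Restriction `C(U, V) → C(U', V)` along `U' ⊆ U`. -/
def res {U U' V : Opens X} (h : U' ≤ U) (f : C.Hom U V) : C.Hom U' V := C.comp f (C.incl h)

theorem res_self {U V : Opens X} (f : C.Hom U V) : C.res le_rfl f = f := by
  rw [res, C.incl_refl, C.comp_id]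

theorem res_res {U U' U'' V : Opens X} (h : U' ≤ U) (k : U'' ≤ U') (f : C.Hom U V) :
    C.res k (C.res h f) = C.res (k.trans h) f := by
  rw [res, res, res, C.assoc, C.incl_trans k h]

theorem comp_res {U U' V W : Opens X} (h : U' ≤ U) (g : C.Hom V W) (f : C.Hom U V) :
    C.res h (C.comp g f) = C.comp g (C.res h f) := C.assoc _ _ _

/-- The presheaf `C(-, V)` on `X`. -/
def presheaf (V : Opens X) : TopCat.Presheaf (Type u) (TopCat.of X) where
  obj U := C.Hom U.unop V
  map h := ↾(fun f => C.res h.unop.le f)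
  map_id U := by
    ext f
    exact C.res_self f
  map_comp h k := by
    ext f
    exact (C.res_res _ _ f).symm

/-- A morphism of `C` into `V` that is defined on some open neighbourhood of `x`. -/
structure GermRep (x : X) (V : Opens X) where
  dom : Opens X
  mem : x ∈ dom
  hom : C.Hom dom V

/-- Two representatives have the same germ if they agree on a smaller neighbourhood. -/
def germSetoid (x : X) (V : Opens X) : Setoid (C.GermRep x V) where
  r p q := ∃ (W : Opens X) (_ : x ∈ W) (h : W ≤ p.dom) (k : W ≤ q.dom),
    C.res h p.hom = C.res k q.hom
  iseqv :=
    { refl := fun p => ⟨p.dom, p.mem, le_rfl, le_rfl, rfl⟩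
      symm := fun ⟨W, hx, h, k, e⟩ => ⟨W, hx, k, h, e.symm⟩
      trans := fun {p q r} ⟨W, hx, h, k, e⟩ ⟨W', hx', h', k', e'⟩ =>
        ⟨W ⊓ W', ⟨hx, hx'⟩, inf_le_left.trans h, inf_le_right.trans k', by
          rw [← C.res_res h inf_le_left, e, C.res_res, ← C.res_res k' inf_le_right, ← e',
            C.res_res]⟩ }

/-- The stalk `C_x(V)`, the colimit of the sets `C(U, V)` over the open neighbourhoods `U`
of `x`. -/
def Germ (x : X) (V : Opens X) : Type u := Quotient (C.germSetoid x V)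

/-- The germ `f_x`. -/
def germ {U V : Opens X} (f : C.Hom U V) (x : X) (hx : x ∈ U) : C.Germ x V :=
  Quotient.mk (C.germSetoid x V) ⟨U, hx, f⟩

theorem germ_eq_of_res {x : X} {U U' V W : Opens X} {f : C.Hom U V} {g : C.Hom U' V}
    {hx : x ∈ U} {hx' : x ∈ U'} (hW : x ∈ W) (h : W ≤ U) (k : W ≤ U')
    (e : C.res h f = C.res k g) : C.germ f x hx = C.germ g x hx' :=
  Quotient.sound (s := C.germSetoid x V) ⟨W, hW, h, k, e⟩

theorem germ_res {x : X} {U W V : Opens X} (f : C.Hom U V) (h : W ≤ U) (hx : x ∈ W) :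
    C.germ (C.res h f) x hx = C.germ f x (h hx) :=
  C.germ_eq_of_res hx le_rfl h (C.res_res _ _ _)

theorem Germ.exists_rep {C : PseudogroupTriple X} {x : X} {V : Opens X} (α : C.Germ x V) :
    ∃ (U : Opens X) (hx : x ∈ U) (f : C.Hom U V), C.germ f x hx = α := by
  obtain ⟨p, rfl⟩ := Quotient.exists_rep α
  exact ⟨p.dom, p.mem, p.hom, rfl⟩

theorem under_res {U U' V : Opens X} (h : U' ≤ U) (f : C.Hom U V) (x : X) (hx : x ∈ U') :
    (C.under (C.res h f)).1 ⟨x, hx⟩ = (C.under f).1 ⟨x, h hx⟩ := by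
  rw [res, C.under_comp, C.under_incl]
  rfl

/-- The value `f̄(x)`, which depends only on the germ `f_x`. -/
def Germ.val {C : PseudogroupTriple X} {x : X} {V : Opens X} (α : C.Germ x V) : X :=
  Quotient.lift (s := C.germSetoid x V) (fun p => ((C.under p.hom).1 ⟨x, p.mem⟩ : X))
    (fun p q ⟨W, hx, h, k, e⟩ => by
      rw [← C.under_res h p.hom x hx, e, C.under_res k q.hom x hx]) α

/-- The map `C_x(V) → C_x(W)`, `f_x ↦ (g ∘ f)_x`, given by `g` in `C(V, W)`. -/
def postcomp {V W : Opens X} (g : C.Hom V W) {x : X} (α : C.Germ x V) : C.Germ x W :=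
  Quotient.lift (s := C.germSetoid x V) (fun p => C.germ (C.comp g p.hom) x p.mem)
    (fun p q ⟨Z, hx, h, k, e⟩ => C.germ_eq_of_res hx h k (by
      rw [C.comp_res, C.comp_res, e])) α

theorem postcomp_germ {U V W : Opens X} (g : C.Hom V W) (f : C.Hom U V) {x : X} (hx : x ∈ U) :
    C.postcomp g (C.germ f x hx) = C.germ (C.comp g f) x hx := rfl

theorem postcomp_comp {V W Z : Opens X} (k : C.Hom W Z) (g : C.Hom V W) {x : X}
    (α : C.Germ x V) : C.postcomp (C.comp k g) α = C.postcomp k (C.postcomp g α) := by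
  obtain ⟨U, hx, f, rfl⟩ := α.exists_rep
  simp only [postcomp_germ, C.assoc]

theorem val_germ {U V : Opens X} (f : C.Hom U V) {x : X} (hx : x ∈ U) :
    (C.germ f x hx).val = ((C.under f).1 ⟨x, hx⟩ : X) := rfl

theorem postcomp_id {V : Opens X} {x : X} (α : C.Germ x V) : C.postcomp (C.id V) α = α := by
  obtain ⟨U, hx, f, rfl⟩ := α.exists_rep
  rw [postcomp_germ, C.id_comp]

theorem val_postcomp_incl {V W : Opens X} (h : V ≤ W) {x : X} (α : C.Germ x V) :
    (C.postcomp (C.incl h) α).val = α.val := by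
  obtain ⟨U, hx, f, rfl⟩ := α.exists_rep
  rw [postcomp_germ, val_germ, val_germ, C.under_comp, C.under_incl]
  rfl

/-- For all `x` and `V`, the natural map `C_x(V) → C_x(X)` is a bijection onto the set of the germs
`f_x` with `f̄(x) ∈ V`. Equivalently `C_x(V) ≅ ∐_{y ∈ V} C⋆(x, y)`. This is what makes the
composition of germs in `C⋆` well defined. -/
def GermCondition : Prop :=
  ∀ (x : X) (V : Opens X),
    Set.BijOn (fun α : C.Germ x V => C.postcomp (C.incl (le_top : V ≤ ⊤)) α) Set.univ
      {α : C.Germ x ⊤ | α.val ∈ V}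

section Star

variable {C} (hC : C.GermCondition)

/-- The germ `f_x` in `C_x(X)`, seen in `C_x(V)` when `f̄(x) ∈ V`. -/
noncomputable def liftGerm {x : X} (α : C.Germ x ⊤) (V : Opens X) (hV : α.val ∈ V) : C.Germ x V :=
  ((hC x V).surjOn hV).choose

theorem postcomp_liftGerm {x : X} (α : C.Germ x ⊤) (V : Opens X) (hV : α.val ∈ V) :
    C.postcomp (C.incl le_top) (liftGerm hC α V hV) = α :=
  ((hC x V).surjOn hV).choose_spec.2

theorem eq_liftGerm {x : X} (α : C.Germ x ⊤) (V : Opens X) (hV : α.val ∈ V) (β : C.Germ x V)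
    (h : C.postcomp (C.incl le_top) β = α) : β = liftGerm hC α V hV :=
  (hC x V).injOn (Set.mem_univ _) (Set.mem_univ _) (h.trans (postcomp_liftGerm hC α V hV).symm)

theorem postcomp_incl_liftGerm {x : X} (α : C.Germ x ⊤) {V W : Opens X} (h : W ≤ V)
    (hW : α.val ∈ W) :
    C.postcomp (C.incl h) (liftGerm hC α W hW) = liftGerm hC α V (h hW) := by
  apply eq_liftGerm
  rw [← postcomp_comp, ← C.incl_trans, postcomp_liftGerm]

/-- Composition `g_y ∘ f_x := (g ∘ f)_x`, where `y = f̄(x)`, `g` is in `C(V, X)`, and the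
representative `f` of the germ `f_x` is chosen in some `C(U, V)`. -/
noncomputable def germComp {x y : X} (β : C.Germ y ⊤) (α : C.Germ x ⊤) (hy : α.val = y) :
    C.Germ x ⊤ :=
  Quotient.lift (s := C.germSetoid y ⊤)
    (fun p => C.postcomp p.hom (liftGerm hC α p.dom (hy ▸ p.mem)))
    (fun p q ⟨W, hW, h, k, e⟩ => by
      have hW' : α.val ∈ W := hy ▸ hW
      change _ = _
      rw [← postcomp_incl_liftGerm hC α h hW', ← postcomp_incl_liftGerm hC α k hW',
        ← postcomp_comp, ← postcomp_comp]
      exact congrArg (fun g => C.postcomp g (liftGerm hC α W hW')) e) β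

theorem germComp_germ {x : X} {U V : Opens X} (g : C.Hom V ⊤) (f : C.Hom U V) (hx : x ∈ U)
    {y : X} (hy : y ∈ V) (h : (C.germ (C.comp (C.incl le_top) f) x hx).val = y) :
    germComp hC (C.germ g y hy) (C.germ (C.comp (C.incl le_top) f) x hx) h =
      C.germ (C.comp g f) x hx := by
  have e := eq_liftGerm hC (C.germ (C.comp (C.incl le_top) f) x hx) V (h ▸ hy) (C.germ f x hx) rfl
  change C.postcomp g (liftGerm hC _ V _) = _
  rw [← e, postcomp_germ]

/-- Every germ has a representative with values in a prescribed neighbourhood of its value. -/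
theorem exists_rep_into (hC : C.GermCondition) {x : X} (α : C.Germ x ⊤) (V : Opens X)
    (hV : α.val ∈ V) :
    ∃ (U : Opens X) (hx : x ∈ U) (f : C.Hom U V), C.germ (C.comp (C.incl le_top) f) x hx = α := by
  obtain ⟨U, hx, f, h⟩ := (liftGerm hC α V hV).exists_rep
  exact ⟨U, hx, f, by rw [← postcomp_germ, h, postcomp_liftGerm]⟩

theorem val_comp_incl {x : X} {U V : Opens X} (f : C.Hom U V) (hx : x ∈ U) :
    (C.germ (C.comp (C.incl (le_top : V ≤ ⊤)) f) x hx).val = ((C.under f).1 ⟨x, hx⟩ : X) :=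
  C.val_postcomp_incl le_top (C.germ f x hx)

theorem val_germComp {x y : X} (β : C.Germ y ⊤) (α : C.Germ x ⊤) (hy : α.val = y) :
    (germComp hC β α hy).val = β.val := by
  subst hy
  obtain ⟨V, hV, g, rfl⟩ := β.exists_rep
  obtain ⟨U, hx, f, hf⟩ := exists_rep_into hC α V hV
  subst hf
  rw [germComp_germ, val_germ, val_germ, C.under_comp]
  exact congrArg (fun z => ((C.under g).1 z : X)) (Subtype.ext (val_comp_incl f hx).symm)

/-- The germ of the identity at `x`. -/
def germId (C : PseudogroupTriple X) (x : X) : C.Germ x ⊤ := C.germ (C.id ⊤) x trivial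

theorem val_germId (x : X) : (germId C x).val = x := by
  change ((C.under (C.id ⊤)).1 ⟨x, trivial⟩ : X) = x
  rw [C.under_id]
  rfl

theorem germId_germComp {x y : X} (α : C.Germ x ⊤) (h : α.val = y) :
    germComp hC (germId C y) α h = α := by
  change C.postcomp (C.id ⊤) (liftGerm hC α ⊤ _) = α
  rw [postcomp_id, ← eq_liftGerm hC α ⊤ trivial α]
  rw [C.incl_refl, postcomp_id]

theorem germComp_germId {x : X} (α : C.Germ x ⊤) :
    germComp hC α (germId C x) (val_germId x) = α := by
  obtain ⟨U, hx, f, rfl⟩ := α.exists_rep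
  have h : germId C x = C.germ (C.comp (C.incl le_top) (C.id U)) x hx := by
    refine C.germ_eq_of_res (W := U) hx le_top le_rfl ?_
    rw [C.res_self, C.comp_id, res, C.id_comp]
  have key : ∀ (γ : C.Germ x ⊤) (hγ : γ.val = x),
      γ = C.germ (C.comp (C.incl le_top) (C.id U)) x hx →
      germComp hC (C.germ f x hx) γ hγ = C.germ f x hx := by
    rintro γ hγ rfl
    rw [germComp_germ, C.comp_id]
  exact key _ _ h

theorem germComp_assoc {x y z : X} (γ : C.Germ z ⊤) (β : C.Germ y ⊤) (α : C.Germ x ⊤)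
    (hy : α.val = y) (hz : β.val = z) :
    germComp hC (germComp hC γ β hz) α hy =
      germComp hC γ (germComp hC β α hy) ((val_germComp hC β α hy).trans hz) := by
  subst hy hz
  obtain ⟨W, hW, k, rfl⟩ := γ.exists_rep
  obtain ⟨V, hV, g, hg⟩ := exists_rep_into hC β W hW
  subst hg
  obtain ⟨U, hx, f, hf⟩ := exists_rep_into hC α V hV
  subst hf
  rw [germComp_germ, germComp_germ]
  have key : ∀ (δ : C.Germ x ⊤) (hδ : δ.val = _),
      δ = C.germ (C.comp (C.incl le_top) (C.comp g f)) x hx →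
      C.germ (C.comp (C.comp k g) f) x hx = germComp hC (C.germ k _ hW) δ hδ := by
    rintro δ hδ rfl
    rw [germComp_germ, C.assoc]
  exact key _ _ (by rw [germComp_germ, C.assoc])

/-- The category `C⋆`: its objects are the points of `X`. -/
structure Star (hC : C.GermCondition) where
  pt : X

/-- `C⋆(x, y)` is the set of the germs `f_x` in `C_x(X)` with `f̄(x) = y`. -/
noncomputable instance : Category.{u} (Star hC) where
  Hom x y := {α : C.Germ x.pt ⊤ // α.val = y.pt}
  id x := ⟨germId C x.pt, val_germId _⟩
  comp α β := ⟨germComp hC β.1 α.1 α.2, (val_germComp hC _ _ _).trans β.2⟩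
  id_comp α := Subtype.ext (germComp_germId hC α.1)
  comp_id α := Subtype.ext (germId_germComp hC α.1 α.2)
  assoc α β γ := Subtype.ext (germComp_assoc hC γ.1 β.1 α.1 α.2 β.2).symm

end Star

/-- Pre-pseudogroups on an arbitrary space: germs compose, and the category `C⋆` of germs is a
groupoid. -/
structure IsPrePseudogroup : Prop where
  germCondition : C.GermCondition
  isGroupoid : IsGroupoid (Star germCondition)

/-- Pseudogroup sheaves: pre-pseudogroups such that every presheaf `C(-, V)` is a sheaf. -/
structure IsPseudogroupSheaf : Prop extends C.IsPrePseudogroup where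
  isSheaf : ∀ V : Opens X, (C.presheaf V).IsSheaf

/-- Isomorphisms of triples: isomorphisms of categories that are the identity on objects and
commute with the functors from `X_top` and to `Homeo^l_X`. -/
structure Iso (C D : PseudogroupTriple X) where
  homEquiv : ∀ {U V : Opens X}, C.Hom U V ≃ D.Hom U V
  map_comp : ∀ {U V W : Opens X} (g : C.Hom V W) (f : C.Hom U V),
    homEquiv (C.comp g f) = D.comp (homEquiv g) (homEquiv f)
  map_incl : ∀ {U V : Opens X} (h : U ≤ V), homEquiv (C.incl h) = D.incl h
  under_map : ∀ {U V : Opens X} (f : C.Hom U V), D.under (homEquiv f) = C.under f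

end PseudogroupTriple

/-- The pseudogroup sheaves on `X`. -/
structure PseudogroupSheaf (X : Type u) [TopologicalSpace X] extends PseudogroupTriple X where
  isPseudogroupSheaf : toPseudogroupTriple.IsPseudogroupSheaf

/-- Being isomorphic, as a relation on pseudogroup sheaves. -/
def PseudogroupSheaf.isoSetoid (X : Type u) [TopologicalSpace X] :
    Setoid (PseudogroupSheaf X) where
  r C D := Nonempty (PseudogroupTriple.Iso C.1 D.1)
  iseqv :=
    { refl := fun _ => ⟨⟨Equiv.refl _, fun _ _ => rfl, fun _ => rfl, fun _ => rfl⟩⟩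
      symm := fun {C D} ⟨φ⟩ => ⟨⟨φ.homEquiv.symm,
        fun g f => by
          rw [Equiv.symm_apply_eq, φ.map_comp, Equiv.apply_symm_apply, Equiv.apply_symm_apply],
        fun h => by rw [Equiv.symm_apply_eq, φ.map_incl],
        fun f => by rw [← φ.under_map, Equiv.apply_symm_apply]⟩⟩
      trans := fun ⟨φ⟩ ⟨ψ⟩ => ⟨⟨φ.homEquiv.trans ψ.homEquiv,
        fun g f => by simp only [Equiv.trans_apply, φ.map_comp, ψ.map_comp],
        fun h => by simp only [Equiv.trans_apply, φ.map_incl, ψ.map_incl],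
        fun f => by simp only [Equiv.trans_apply, φ.under_map, ψ.under_map]⟩⟩ }

/-- A groupoid with the points of `X` as its objects, together with a topology on its set of
arrows (no compatibility yet). -/
structure GroupoidOver (X : Type u) [TopologicalSpace X] where
  Arr : Type u
  top : TopologicalSpace Arr
  /-- source -/
  s : Arr → X
  /-- target -/
  t : Arr → X
  /-- identities -/
  i : X → Arr
  inv : Arr → Arr
  /-- `comp g f` is defined when the source of `g` is the target of `f`. -/
  comp : ∀ g f : Arr, s g = t f → Arr
  s_i : ∀ x, s (i x) = x
  t_i : ∀ x, t (i x) = x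
  s_inv : ∀ g, s (inv g) = t g
  t_inv : ∀ g, t (inv g) = s g
  s_comp : ∀ g f h, s (comp g f h) = s f
  t_comp : ∀ g f h, t (comp g f h) = t g
  id_comp : ∀ f, comp (i (t f)) f (s_i _) = f
  comp_id : ∀ f, comp f (i (s f)) (t_i _).symm = f
  assoc : ∀ k g f (h₁ : s k = t g) (h₂ : s g = t f),
    comp (comp k g h₁) f ((s_comp _ _ _).trans h₂) =
      comp k (comp g f h₂) (h₁.trans (t_comp _ _ _).symm)
  inv_comp : ∀ f, comp (inv f) f (s_inv f) = i (s f)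
  comp_inv : ∀ f, comp f (inv f) (t_inv f).symm = i (t f)

attribute [instance] GroupoidOver.top

namespace GroupoidOver

variable {X : Type u} [TopologicalSpace X]

/-- The structure maps are continuous, and source and target are local homeomorphisms. -/
structure IsEtale (G : GroupoidOver X) : Prop where
  continuous_i : Continuous G.i
  continuous_inv : Continuous G.inv
  continuous_comp :
    Continuous fun p : {p : G.Arr × G.Arr // G.s p.1 = G.t p.2} => G.comp p.1.1 p.1.2 p.2
  isLocalHomeomorph_s : IsLocalHomeomorph G.s
  isLocalHomeomorph_t : IsLocalHomeomorph G.t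

/-- Isomorphisms of groupoids over `X`: homeomorphisms between the spaces of arrows that respect
source, target and composition (hence identities and inverses), and are the identity on `X`. -/
structure Iso (G H : GroupoidOver X) where
  homeo : G.Arr ≃ₜ H.Arr
  s_map : ∀ g, H.s (homeo g) = G.s g
  t_map : ∀ g, H.t (homeo g) = G.t g
  map_comp : ∀ (g f : G.Arr) (h : G.s g = G.t f),
    homeo (G.comp g f h) = H.comp (homeo g) (homeo f) (by rw [s_map, t_map, h])

end GroupoidOver

/-- The topological étale groupoids over `X`. -/
structure EtaleGroupoid (X : Type u) [TopologicalSpace X] extends GroupoidOver X where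
  isEtale : toGroupoidOver.IsEtale

/-- Being isomorphic, as a relation on étale groupoids over `X`. -/
def EtaleGroupoid.isoSetoid (X : Type u) [TopologicalSpace X] : Setoid (EtaleGroupoid X) where
  r G H := Nonempty (GroupoidOver.Iso G.1 H.1)
  iseqv :=
    { refl := fun _ => ⟨⟨Homeomorph.refl _, fun _ => rfl, fun _ => rfl, fun _ _ _ => rfl⟩⟩
      symm := fun {G H} ⟨φ⟩ => by
        have hs : ∀ g, G.1.s (φ.homeo.symm g) = H.1.s g := fun g => by
          rw [← φ.s_map, Homeomorph.apply_symm_apply]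
        have ht : ∀ g, G.1.t (φ.homeo.symm g) = H.1.t g := fun g => by
          rw [← φ.t_map, Homeomorph.apply_symm_apply]
        refine ⟨⟨φ.homeo.symm, hs, ht, fun g f h => ?_⟩⟩
        apply φ.homeo.injective
        rw [φ.map_comp, Homeomorph.apply_symm_apply]
        simp only [Homeomorph.apply_symm_apply]
      trans := fun ⟨φ⟩ ⟨ψ⟩ => ⟨⟨φ.homeo.trans ψ.homeo,
        fun g => by simp only [Homeomorph.trans_apply, φ.s_map, ψ.s_map],
        fun g => by simp only [Homeomorph.trans_apply, φ.t_map, ψ.t_map],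
        fun g f h => by simp only [Homeomorph.trans_apply, φ.map_comp, ψ.map_comp]⟩⟩ }

namespace EtaleGroupoid

variable {X : Type u} [TopologicalSpace X] (G : EtaleGroupoid X)

/-- The set `Ĝ(U, V)` of the continuous maps `f : U → t⁻¹(V)` with `s ∘ f = id`. -/
structure Section (U V : Opens X) where
  toFun : U → G.1.Arr
  continuous_toFun : Continuous toFun
  s_toFun : ∀ x : U, G.1.s (toFun x) = x
  t_mem : ∀ x : U, G.1.t (toFun x) ∈ V

variable {G}

theorem Section.ext_fun {U V : Opens X} {f g : G.Section U V} (h : ∀ x, f.toFun x = g.toFun x) :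
    f = g := by
  cases f
  cases g
  congr
  exact funext h

/-- The underlying map `t ∘ f` of a section `f`. -/
def Section.under {U V : Opens X} (f : G.Section U V) (x : U) : V :=
  ⟨G.1.t (f.toFun x), f.t_mem x⟩

theorem Section.coe_under {U V : Opens X} (f : G.Section U V) (x : U) :
    (f.under x : X) = G.1.t (f.toFun x) := rfl

theorem Section.isLocalHomeomorph_under {U V : Opens X} (f : G.Section U V) :
    IsLocalHomeomorph f.under := by
  have h₁ : IsLocalHomeomorph f.toFun := by
    have e : G.1.s ∘ f.toFun = ((↑) : U → X) := funext f.s_toFun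
    have h : IsLocalHomeomorph (G.1.s ∘ f.toFun) := by
      rw [e]
      exact U.isOpenEmbedding'.isLocalHomeomorph
    exact h.of_comp G.2.isLocalHomeomorph_s f.continuous_toFun
  have hV : IsLocalHomeomorph ((↑) : V → X) := V.isOpenEmbedding'.isLocalHomeomorph
  have h₂ : IsLocalHomeomorph (((↑) : V → X) ∘ f.under) := G.2.isLocalHomeomorph_t.comp h₁
  exact h₂.of_comp hV (h₂.continuous.subtype_mk _)

/-- The section `x ↦ i(x)`, in `Ĝ(U, V)` for `U ⊆ V`. -/
def Section.incl {U V : Opens X} (h : U ≤ V) : G.Section U V where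
  toFun x := G.1.i x
  continuous_toFun := G.2.continuous_i.comp continuous_subtype_val
  s_toFun x := G.1.s_i x
  t_mem x := by
    rw [G.1.t_i]
    exact h x.2

/-- Composition of sections: `x ↦ g(t(f(x))) · f(x)`. -/
def Section.comp {U V W : Opens X} (g : G.Section V W) (f : G.Section U V) : G.Section U W where
  toFun x := G.1.comp (g.toFun (f.under x)) (f.toFun x)
    ((g.s_toFun (f.under x)).trans (f.coe_under x))
  continuous_toFun := by
    have h : Continuous fun x : U =>
        (⟨(g.toFun (f.under x), f.toFun x), (g.s_toFun _).trans (f.coe_under x)⟩ :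
          {p : G.1.Arr × G.1.Arr // G.1.s p.1 = G.1.t p.2}) :=
      ((g.continuous_toFun.comp f.isLocalHomeomorph_under.continuous).prodMk
        f.continuous_toFun).subtype_mk _
    exact G.2.continuous_comp.comp h
  s_toFun x := (G.1.s_comp _ _ _).trans (f.s_toFun x)
  t_mem x := (G.1.t_comp _ _ _).symm ▸ g.t_mem (f.under x)

theorem comp_congr {H : GroupoidOver X} {g g' f f' : H.Arr} (hg : g = g') (hf : f = f')
    (h : H.s g = H.t f) : H.comp g f h = H.comp g' f' (hg ▸ hf ▸ h) := by
  subst hg hf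
  rfl

theorem Section.under_comp {U V W : Opens X} (g : G.Section V W) (f : G.Section U V) (x : U) :
    (g.comp f).under x = g.under (f.under x) :=
  Subtype.ext (G.1.t_comp _ _ _)

theorem Section.under_incl {U V : Opens X} (h : U ≤ V) (x : U) :
    (Section.incl h : G.Section U V).under x = Set.inclusion h x :=
  Subtype.ext (G.1.t_i _)

variable (G)

/-- The category `Ĝ` of sections, with the functors `X_top ⊂ Ĝ` (given by the identities of `G`)
and `f ↦ t ∘ f` to `Homeo^l_X`. -/
def sectionTriple : PseudogroupTriple X where
  Hom U V := G.Section U V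
  id U := Section.incl le_rfl
  comp g f := g.comp f
  id_comp f := Section.ext_fun fun x => G.1.id_comp (f.toFun x)
  comp_id {U V} f := Section.ext_fun fun x => by
    refine (comp_congr (f' := G.1.i (G.1.s (f.toFun x))) ?_ ?_ _).trans (G.1.comp_id (f.toFun x))
    · exact congrArg f.toFun (Section.under_incl le_rfl x)
    · exact congrArg G.1.i (f.s_toFun x).symm
  assoc k g f := Section.ext_fun fun x => by
    refine Eq.trans ?_ ((G.1.assoc (k.toFun (g.under (f.under x))) (g.toFun (f.under x))
      (f.toFun x) (k.s_toFun _) (g.s_toFun _)).trans ?_)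
    · rfl
    · exact comp_congr (congrArg k.toFun (Section.under_comp g f x).symm) rfl _
  incl h := Section.incl h
  incl_refl U := rfl
  incl_trans {U V W} h k := Section.ext_fun fun x => by
    symm
    refine (comp_congr (g' := G.1.i (G.1.t (G.1.i x))) ?_ rfl _).trans (G.1.id_comp (G.1.i x))
    rfl
  under f := ⟨f.under, f.isLocalHomeomorph_under⟩
  under_id U := LocHomeo.ext (funext fun x => Section.under_incl le_rfl x)
  under_comp g f := LocHomeo.ext (funext fun x => Section.under_comp g f x)
  under_incl h := LocHomeo.ext (funext fun x => Section.under_incl h x)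

end EtaleGroupoid

namespace PseudogroupSheaf

variable {X : Type u} [TopologicalSpace X] (C : PseudogroupSheaf X)

/-- The étale space of the presheaf `C(-, X)`, i.e. the set of morphisms of `C⋆`. -/
def EtaleSpace : Type u := Σ x : X, C.1.Germ x ⊤

/-- The subset `[f, U] = {f_x | x ∈ U}` of the étale space, for `f` in `C(U, X)`. -/
def basicOpen {U : Opens X} (f : C.1.Hom U ⊤) : Set C.EtaleSpace :=
  {e | ∃ (x : X) (hx : x ∈ U), e = ⟨x, C.1.germ f x hx⟩}

/-- The topology of the étale space is generated by the sets `[f, U]`. -/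
instance : TopologicalSpace C.EtaleSpace :=
  TopologicalSpace.generateFrom {B | ∃ (U : Opens X) (f : C.1.Hom U ⊤), B = C.basicOpen f}

/-- An element of the étale space as a morphism of `C⋆`. -/
def toStar (e : C.EtaleSpace) :
    (⟨e.1⟩ : PseudogroupTriple.Star C.2.germCondition) ⟶ ⟨e.2.val⟩ :=
  ⟨e.2, rfl⟩

/-- The inverse in `C⋆` of an element of the étale space. -/
noncomputable def starInv (e : C.EtaleSpace) :
    (⟨e.2.val⟩ : PseudogroupTriple.Star C.2.germCondition) ⟶ ⟨e.1⟩ :=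
  have := C.2.isGroupoid
  CategoryTheory.inv (C.toStar e)

theorem toStar_starInv (e : C.EtaleSpace) : C.toStar e ≫ C.starInv e = 𝟙 _ := by
  have := C.2.isGroupoid
  exact IsIso.hom_inv_id (C.toStar e)

theorem starInv_toStar (e : C.EtaleSpace) : C.starInv e ≫ C.toStar e = 𝟙 _ := by
  have := C.2.isGroupoid
  exact IsIso.inv_hom_id (C.toStar e)

open PseudogroupTriple in
/-- The groupoid `C⋆`, with the topology of the étale space of `C(-, X)` on its arrows. -/
noncomputable def germGroupoid : GroupoidOver X where
  Arr := C.EtaleSpace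
  top := inferInstance
  s e := e.1
  t e := e.2.val
  i x := ⟨x, germId C.1 x⟩
  inv e := ⟨e.2.val, (C.starInv e).1⟩
  comp g f h := ⟨f.1, germComp C.2.germCondition g.2 f.2 h.symm⟩
  s_i _ := rfl
  t_i x := val_germId x
  s_inv _ := rfl
  t_inv e := (C.starInv e).2
  s_comp _ _ _ := rfl
  t_comp g f h := val_germComp C.2.germCondition g.2 f.2 h.symm
  id_comp f := congrArg (Sigma.mk f.1) (germId_germComp C.2.germCondition f.2 rfl)
  comp_id f := congrArg (Sigma.mk f.1) (germComp_germId C.2.germCondition f.2)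
  assoc k g f h₁ h₂ := congrArg (Sigma.mk f.1)
    (germComp_assoc C.2.germCondition k.2 g.2 f.2 h₂.symm h₁.symm)
  inv_comp e := congrArg (Sigma.mk e.1) (congrArg Subtype.val (C.toStar_starInv e))
  comp_inv e := congrArg (Sigma.mk e.2.val) (congrArg Subtype.val (C.starInv_toStar e))

end PseudogroupSheaf

/-! ### Preliminaries on germs and on cancellation in groupoids -/

namespace PseudogroupTriple

variable {X : Type u} [TopologicalSpace X] (C : PseudogroupTriple X)

/-! This is the correspondence between sheaves and étale spaces, carrying a composition law.
Everything rests on one fact: two continuous sections of a local homeomorphism that agree at a point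
agree near it.

For an étale groupoid `G`, the source is a local homeomorphism. Hence a germ at `x` of sections into
`t⁻¹(V)` is determined by its value at `x` (`evalGerm_injective`), and every arrow from `x` to a
point of `V` is such a value (`exists_evalGerm_eq`). Evaluation is multiplicative
(`evalGerm_germComp`), so the germ condition and the inverses in the category of germs are read off
from `G`, and the groupoid of germs is `G` again, topology included (`isLocalHomeomorph_evalGerm`).

For a pseudogroup sheaf `C`, an equality of germs at a point persists on a neighbourhood. This makes
the maps `x ↦ f_x` open embeddings that cover the étale space, and makes inversion and composition
of germs continuous. A morphism in `C(U, V)` is sent to its section of germs. This is injective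
because `C(-, V)` is separated, and surjective because a continuous section is locally of the form
`x ↦ f_x` and the local morphisms glue. The germ condition allows any target `V` here, although
arrows are germs in `C_x(X)`.

Both constructions respect isomorphisms, so they descend to isomorphism classes. -/

theorem germ_eq_iff {x : X} {U U' V : Opens X} {f : C.Hom U V} {g : C.Hom U' V}
    {hx : x ∈ U} {hx' : x ∈ U'} :
    C.germ f x hx = C.germ g x hx' ↔
      ∃ (W : Opens X) (_ : x ∈ W) (h : W ≤ U) (k : W ≤ U'), C.res h f = C.res k g :=
  ⟨fun e => Quotient.exact (s := C.germSetoid x V) e,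
    fun ⟨_, hW, h, k, e⟩ => C.germ_eq_of_res hW h k e⟩

end PseudogroupTriple

namespace GroupoidOver

variable {X : Type u} [TopologicalSpace X]

theorem comp_congr (G : GroupoidOver X) {g g' f f' : G.Arr} (hg : g = g') (hf : f = f')
    (h : G.s g = G.t f) (h' : G.s g' = G.t f') : G.comp g f h = G.comp g' f' h' := by
  subst hg hf
  rfl

/-- Cancel `f` by composing with `G.inv f` on the right. This identifies the inverse of a germ from
a representative, without unfolding the abstract inverse in `C⋆`. -/
theorem eq_inv_of_comp_eq (G : GroupoidOver X) {g f : G.Arr} (h : G.s g = G.t f)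
    (e : G.comp g f h = G.i (G.s f)) : g = G.inv f := by
  have h₁ : G.comp (G.comp g f h) (G.inv f) ((G.s_comp _ _ _).trans (G.t_inv f).symm) = g := by
    rw [G.assoc]
    refine (G.comp_congr rfl ((G.comp_inv f).trans (congrArg G.i h.symm)) _
      (G.t_i _).symm).trans (G.comp_id g)
  rw [← h₁]
  refine (G.comp_congr (e.trans (congrArg G.i (G.t_inv f).symm)) rfl _ (G.s_i _)).trans
    (G.id_comp _)

/-- Cancel one factor `g`. Since idempotents are identities, a map that respects composition also
respects identities. -/
theorem eq_i_of_comp_self (G : GroupoidOver X) {g : G.Arr} (h : G.s g = G.t g)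
    (e : G.comp g g h = g) : g = G.i (G.s g) := by
  have h₁ : G.comp (G.inv g) (G.comp g g h) ((G.s_inv g).trans (G.t_comp _ _ _).symm) = g := by
    rw [← G.assoc _ _ _ (G.s_inv g) h]
    exact (G.comp_congr ((G.inv_comp g).trans (congrArg G.i h)) rfl _ (G.s_i _)).trans
      (G.id_comp g)
  exact h₁.symm.trans ((G.comp_congr rfl e _ (G.s_inv g)).trans (G.inv_comp g))

theorem Iso.map_i {G H : GroupoidOver X} (φ : Iso G H) (x : X) : φ.homeo (G.i x) = H.i x := by
  have h : G.s (G.i x) = G.t (G.i x) := (G.s_i x).trans (G.t_i x).symm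
  have e : G.comp (G.i x) (G.i x) h = G.i x :=
    (G.comp_congr (congrArg G.i (G.t_i x).symm) rfl _ (G.s_i _)).trans (G.id_comp (G.i x))
  have e' := φ.map_comp _ _ h
  rw [e] at e'
  rw [H.eq_i_of_comp_self _ e'.symm, φ.s_map, G.s_i]

theorem inv_inv (G : GroupoidOver X) (f : G.Arr) : G.inv (G.inv f) = f :=
  (G.eq_inv_of_comp_eq (G.t_inv f).symm ((G.comp_inv f).trans
    (congrArg G.i (G.s_inv f).symm))).symm

end GroupoidOver

/-! ### The étale space of germs is an étale groupoid -/

namespace PseudogroupSheaf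

open PseudogroupTriple

variable {X : Type u} [TopologicalSpace X] (C : PseudogroupSheaf X)

/-- The section `x ↦ f_x` of the étale space given by `f` in `C(U, X)`. -/
def germSection {U : Opens X} (f : C.1.Hom U ⊤) (x : U) : C.EtaleSpace :=
  ⟨x, C.1.germ f x x.2⟩

variable {C}

theorem exists_germSection_eq (e : C.EtaleSpace) :
    ∃ (U : Opens X) (f : C.1.Hom U ⊤) (x : U), C.germSection f x = e := by
  obtain ⟨x, α⟩ := e
  obtain ⟨U, hx, f, rfl⟩ := α.exists_rep
  exact ⟨U, f, ⟨x, hx⟩, rfl⟩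

/-- The surjectivity half of the germ condition: it supplies representatives that can be composed
with a given morphism out of `V`. -/
theorem exists_germSection_eq_into (e : C.EtaleSpace) (V : Opens X) (hV : e.2.val ∈ V) :
    ∃ (U : Opens X) (f : C.1.Hom U V) (x : U),
      C.germSection (C.1.comp (C.1.incl le_top) f) x = e := by
  obtain ⟨x, α⟩ := e
  obtain ⟨U, hx, f, rfl⟩ := exists_rep_into C.2.germCondition α V hV
  exact ⟨U, f, ⟨x, hx⟩, rfl⟩

theorem range_germSection {U : Opens X} (f : C.1.Hom U ⊤) :
    Set.range (C.germSection f) = C.basicOpen f := by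
  ext e
  constructor
  · rintro ⟨x, rfl⟩
    exact ⟨x, x.2, rfl⟩
  · rintro ⟨x, hx, rfl⟩
    exact ⟨⟨x, hx⟩, rfl⟩

theorem germSection_mem_basicOpen {U : Opens X} (f : C.1.Hom U ⊤) (x : U) :
    C.germSection f x ∈ C.basicOpen f := ⟨x, x.2, rfl⟩

theorem isOpen_basicOpen {U : Opens X} (f : C.1.Hom U ⊤) : IsOpen (C.basicOpen f) :=
  isOpen_generateFrom_of_mem ⟨U, f, rfl⟩

theorem germSection_res {U W : Opens X} (f : C.1.Hom U ⊤) (h : W ≤ U) (x : W) :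
    C.germSection (C.1.res h f) x = C.germSection f ⟨x, h x.2⟩ :=
  congrArg (Sigma.mk _) (C.1.germ_res f h x.2)

theorem germSection_eq_iff {U U' : Opens X} {f : C.1.Hom U ⊤} {g : C.1.Hom U' ⊤} {x : U} {y : U'} :
    C.germSection f x = C.germSection g y ↔
      (x : X) = y ∧ ∃ (W : Opens X) (_ : (x : X) ∈ W) (h : W ≤ U) (k : W ≤ U'),
        C.1.res h f = C.1.res k g := by
  obtain ⟨x, hx⟩ := x
  obtain ⟨y, hy⟩ := y
  constructor
  · intro e
    obtain rfl : x = y := congrArg Sigma.fst e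
    exact ⟨rfl, C.1.germ_eq_iff.1 (eq_of_heq (Sigma.mk.inj e).2)⟩
  · rintro ⟨rfl : x = y, h⟩
    exact congrArg (Sigma.mk x) (C.1.germ_eq_iff.2 h)

/-- If `f` and `g` have the same germ at a point, they agree on some `Z` around it, so all of `Z`
lies in the preimage of `[g, W]`. -/
theorem continuous_germSection {U : Opens X} (f : C.1.Hom U ⊤) : Continuous (C.germSection f) := by
  refine continuous_generateFrom_iff.2 ?_
  rintro _ ⟨W, g, rfl⟩
  rw [← range_germSection]
  refine isOpen_iff_forall_mem_open.2 ?_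
  rintro x ⟨y, e⟩
  obtain ⟨-, Z, hZ, h, k, e⟩ := germSection_eq_iff.1 e.symm
  refine ⟨Subtype.val ⁻¹' (Z : Set X), ?_, Z.2.preimage continuous_subtype_val, hZ⟩
  intro z hz
  exact ⟨⟨z, k hz⟩, germSection_eq_iff.2 ⟨rfl, Z, hz, k, h, e.symm⟩⟩

theorem continuous_source : Continuous (fun e : C.EtaleSpace => e.1) := by
  refine continuous_def.2 fun W hW => isOpen_iff_forall_mem_open.2 fun e he => ?_
  obtain ⟨U, f, x, rfl⟩ := exists_germSection_eq e
  refine ⟨C.basicOpen (C.1.res (inf_le_left : U ⊓ ⟨W, hW⟩ ≤ U) f), ?_, isOpen_basicOpen _, ?_⟩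
  · rintro _ ⟨y, hy, rfl⟩
    exact hy.2
  · exact ⟨x, ⟨x.2, he⟩, (germSection_res f inf_le_left ⟨x, x.2, he⟩).symm⟩

theorem isOpenEmbedding_germSection {U : Opens X} (f : C.1.Hom U ⊤) :
    Topology.IsOpenEmbedding (C.germSection f) := by
  refine .of_continuous_injective_isOpenMap (continuous_germSection f)
    (fun x y e => Subtype.ext (congrArg Sigma.fst e)) fun O hO => ?_
  obtain ⟨O, hO', rfl⟩ := isOpen_induced_iff.1 hO
  have h : IsOpen ((fun e : C.EtaleSpace => e.1) ⁻¹' O) := hO'.preimage continuous_source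
  convert (isOpen_basicOpen f).inter h using 1
  rw [← range_germSection]
  ext e
  constructor
  · rintro ⟨x, hx, rfl⟩
    exact ⟨⟨x, rfl⟩, hx⟩
  · rintro ⟨⟨x, rfl⟩, hx⟩
    exact ⟨x, hx, rfl⟩

/-- Continuity is local, and the open embeddings `germSection f` cover the étale space. -/
theorem continuous_of_comp_germSection {Y : Type*} [TopologicalSpace Y] {p : C.EtaleSpace → Y}
    (h : ∀ (U : Opens X) (f : C.1.Hom U ⊤), Continuous fun x => p (C.germSection f x)) :
    Continuous p := by
  refine continuous_iff_continuousAt.2 fun e => ?_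
  obtain ⟨U, f, x, rfl⟩ := exists_germSection_eq e
  exact (isOpenEmbedding_germSection f).continuousAt_iff.1 (h U f).continuousAt

theorem isOpenMap_source : IsOpenMap (fun e : C.EtaleSpace => e.1) := by
  refine fun O hO => isOpen_iff_forall_mem_open.2 ?_
  rintro _ ⟨e, he, rfl⟩
  obtain ⟨U, f, x, rfl⟩ := exists_germSection_eq e
  refine ⟨Subtype.val '' (C.germSection f ⁻¹' O), ?_,
    U.isOpenEmbedding'.isOpenMap _ (hO.preimage (continuous_germSection f)), ⟨x, he, rfl⟩⟩
  rintro _ ⟨y, hy, rfl⟩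
  exact ⟨_, hy, rfl⟩

theorem isLocalHomeomorph_source : IsLocalHomeomorph (fun e : C.EtaleSpace => e.1) := by
  refine isLocalHomeomorph_iff_isOpenEmbedding_restrict.2 fun e => ?_
  obtain ⟨U, f, x, rfl⟩ := exists_germSection_eq e
  refine ⟨C.basicOpen f, (isOpen_basicOpen f).mem_nhds (germSection_mem_basicOpen f x), ?_⟩
  refine .of_continuous_injective_isOpenMap (continuous_source.comp continuous_subtype_val) ?_
    (isOpenMap_source.domRestrict (isOpen_basicOpen f))
  rintro ⟨_, y, hy, rfl⟩ ⟨_, z, hz, rfl⟩ (h : y = z)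
  subst h
  rfl

/-- If the inverse of `f_x` is a germ of `g`, then `g ∘ f` and the identity have the same germ at
`x`, hence agree on some `Z`. For `z` in `Z`, the germ of `g` at `f̄(z)` is then a left inverse of
`f_z`, so it is the inverse. -/
theorem continuous_inv : Continuous C.germGroupoid.inv := by
  refine continuous_generateFrom_iff.2 ?_
  rintro _ ⟨W, g, rfl⟩
  refine isOpen_iff_forall_mem_open.2 ?_
  rintro e ⟨y, hy, he⟩
  have hye : y = e.2.val := (congrArg Sigma.fst he).symm
  obtain ⟨U, f, x, rfl⟩ := exists_germSection_eq_into e W (hye ▸ hy)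
  have key : C.germGroupoid.comp _ _ (C.germGroupoid.s_inv _) = _ :=
    C.germGroupoid.inv_comp (C.germSection (C.1.comp (C.1.incl le_top) f) x)
  replace key := (C.germGroupoid.comp_congr he.symm
    (rfl : C.germSection (C.1.comp (C.1.incl le_top) f) x = _) hye _).trans key
  have key' : C.1.germ (C.1.comp g f) x x.2 = C.1.germ (C.1.id ⊤) x trivial := by
    rw [← germComp_germ C.2.germCondition g f x.2 hy hye.symm]
    exact eq_of_heq (Sigma.mk.inj key).2
  obtain ⟨Z, hZ, h, k, e⟩ := C.1.germ_eq_iff.1 key'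
  refine ⟨C.basicOpen (C.1.res h (C.1.comp (C.1.incl le_top) f)), ?_, isOpen_basicOpen _,
    ⟨x, hZ, (germSection_res _ h ⟨x, hZ⟩).symm⟩⟩
  rintro _ ⟨z, hz, rfl⟩
  have hv := val_comp_incl (C := C.1) f (h hz)
  refine ⟨((C.1.under f).1 ⟨z, h hz⟩ : X), Subtype.property _, ?_⟩
  symm
  rw [C.1.germ_res _ _ hz]
  refine C.germGroupoid.eq_inv_of_comp_eq hv.symm ?_
  refine congrArg (Sigma.mk z) ((germComp_germ C.2.germCondition g f (h hz) _ hv).trans ?_)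
  exact C.1.germ_eq_of_res hz h k e

/-- If `g_y ∘ f_x` is a germ of `k`, then `g ∘ f` and `k` agree on some `Z` around `x`. Composable
pairs of a germ of `g` and a germ of `f` over `Z` therefore compose to germs of `k`. -/
theorem continuous_comp : Continuous
    fun p : {p : C.EtaleSpace × C.EtaleSpace // p.1.1 = p.2.2.val} =>
      C.germGroupoid.comp p.1.1 p.1.2 p.2 := by
  refine continuous_generateFrom_iff.2 ?_
  rintro _ ⟨W, k, rfl⟩
  refine isOpen_iff_forall_mem_open.2 ?_
  rintro ⟨⟨b, a⟩, hab⟩ hk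
  obtain ⟨V, g, y, rfl⟩ := exists_germSection_eq b
  obtain ⟨U, f, x, rfl⟩ := exists_germSection_eq_into a V
    ((show (y : X) = a.2.val from hab) ▸ y.2)
  rw [← range_germSection] at hk
  obtain ⟨w, hk⟩ := hk
  have e : C.germSection k w = C.germSection (C.1.comp g f) x := hk.trans
    (congrArg (Sigma.mk (x : X)) (germComp_germ C.2.germCondition g f x.2 y.2 hab.symm))
  obtain ⟨hw, Z, hZ, h₁, h₂, e⟩ := germSection_eq_iff.1 e
  refine ⟨Subtype.val ⁻¹' (C.basicOpen g ×ˢ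
      C.basicOpen (C.1.res h₂ (C.1.comp (C.1.incl le_top) f))), ?_,
    ((isOpen_basicOpen _).prod (isOpen_basicOpen _)).preimage continuous_subtype_val,
    ⟨germSection_mem_basicOpen g y,
      ⟨x, hw ▸ hZ, (germSection_res _ h₂ ⟨x, hw ▸ hZ⟩).symm⟩⟩⟩
  rintro ⟨⟨_, _⟩, hab'⟩ ⟨⟨v, hv, rfl⟩, ⟨z, hz, rfl⟩⟩
  refine ⟨z, h₁ hz, congrArg (Sigma.mk z) ?_⟩
  -- The germ is generalised to `γ` because the proof `hγ` depends on it, which blocks direct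
  -- rewriting.
  have key : ∀ (γ : C.1.Germ z ⊤) (hγ : γ.val = v),
      γ = C.1.germ (C.1.comp (C.1.incl le_top) f) z (h₂ hz) →
      germComp C.2.germCondition (C.1.germ g v hv) γ hγ = C.1.germ (C.1.comp g f) z (h₂ hz) := by
    rintro γ hγ rfl
    exact germComp_germ C.2.germCondition g f _ _ _
  exact (key _ hab'.symm (C.1.germ_res _ _ _)).trans (C.1.germ_eq_of_res hz h₂ h₁ e.symm)

theorem isEtale_germGroupoid (C : PseudogroupSheaf X) : C.germGroupoid.IsEtale where
  continuous_i := (isOpenEmbedding_germSection (C.1.id ⊤)).continuous.comp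
    (f := fun x : X => (⟨x, trivial⟩ : (⊤ : Opens X))) (continuous_id.subtype_mk _)
  continuous_inv := continuous_inv
  continuous_comp := continuous_comp
  isLocalHomeomorph_s := isLocalHomeomorph_source
  isLocalHomeomorph_t := by
    -- The target is the source composed with inversion, which is a homeomorphism.
    let φ : C.germGroupoid.Arr ≃ₜ C.germGroupoid.Arr :=
      { toFun := C.germGroupoid.inv
        invFun := C.germGroupoid.inv
        left_inv := C.germGroupoid.inv_inv
        right_inv := C.germGroupoid.inv_inv
        continuous_toFun := continuous_inv
        continuous_invFun := continuous_inv }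
    have h : C.germGroupoid.t = C.germGroupoid.s ∘ φ := funext fun e =>
      (C.germGroupoid.s_inv e).symm
    rw [h]
    exact isLocalHomeomorph_source.comp φ.isLocalHomeomorph

end PseudogroupSheaf

/-! ### Sections of an étale groupoid and their germs -/

namespace EtaleGroupoid

open PseudogroupTriple

variable {X : Type u} [TopologicalSpace X] {G : EtaleGroupoid X}

/-- Restriction in the triple is composition with the section of identities, so it is ordinary
restriction only by the unit law. -/
theorem Section.toFun_res {U U' V : Opens X} (h : U' ≤ U) (f : G.Section U V) (x : U') :
    (G.sectionTriple.res h f).toFun x = f.toFun ⟨x, h x.2⟩ := by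
  have e : (Section.incl h : G.Section U' U).under x = ⟨x, h x.2⟩ := Section.under_incl h x
  refine (G.1.comp_congr (congrArg f.toFun e) (f' := G.1.i (G.1.s (f.toFun ⟨x, h x.2⟩)))
    (congrArg G.1.i (f.s_toFun ⟨x, h x.2⟩).symm) _ (G.1.t_i _).symm).trans (G.1.comp_id _)

theorem Section.toFun_incl_comp {U V W : Opens X} (h : V ≤ W) (f : G.Section U V) (x : U) :
    ((Section.incl h : G.Section V W).comp f).toFun x = f.toFun x :=
  G.1.id_comp (f.toFun x)

/-- The value at `x` of a germ of sections at `x`. -/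
def evalGerm {x : X} {V : Opens X} (α : G.sectionTriple.Germ x V) : G.1.Arr :=
  Quotient.lift (s := G.sectionTriple.germSetoid x V)
    (fun p => Section.toFun p.hom ⟨x, p.mem⟩)
    (fun p q ⟨W, hx, h, k, e⟩ => by
      have e' := congrArg (fun f : G.Section W V => f.toFun ⟨x, hx⟩) e
      exact (Section.toFun_res h p.hom ⟨x, hx⟩).symm.trans
        (e'.trans (Section.toFun_res k q.hom ⟨x, hx⟩))) α

theorem s_evalGerm {x : X} {V : Opens X} (α : G.sectionTriple.Germ x V) :
    G.1.s (evalGerm α) = x := by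
  obtain ⟨U, hx, f, rfl⟩ := α.exists_rep
  exact Section.s_toFun f ⟨x, hx⟩

theorem t_evalGerm {x : X} {V : Opens X} (α : G.sectionTriple.Germ x V) :
    G.1.t (evalGerm α) = α.val := by
  obtain ⟨U, hx, f, rfl⟩ := α.exists_rep
  rfl

theorem val_mem {x : X} {V : Opens X} (α : G.sectionTriple.Germ x V) : α.val ∈ V := by
  obtain ⟨U, hx, f, rfl⟩ := α.exists_rep
  exact Section.t_mem f ⟨x, hx⟩

/-- Since `s` is locally injective, the locus where two of its sections agree is open. -/
theorem evalGerm_injective {x : X} {V : Opens X} :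
    Function.Injective (evalGerm : G.sectionTriple.Germ x V → G.1.Arr) := by
  intro α β e
  obtain ⟨U, hx, f, rfl⟩ := α.exists_rep
  obtain ⟨U', hx', g, rfl⟩ := β.exists_rep
  change f.toFun ⟨x, hx⟩ = g.toFun ⟨x, hx'⟩ at e
  have hf := f.continuous_toFun.comp (continuous_inclusion (inf_le_left : U ⊓ U' ≤ U))
  have hg := g.continuous_toFun.comp (continuous_inclusion (inf_le_right : U ⊓ U' ≤ U'))
  have h := G.2.isLocalHomeomorph_s.isLocallyInjective.isOpen_eqLocus hf hg
    (funext fun y => (f.s_toFun (Set.inclusion (inf_le_left : U ⊓ U' ≤ U) y)).trans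
      (g.s_toFun (Set.inclusion (inf_le_right : U ⊓ U' ≤ U') y)).symm)
  -- The neighbourhood is the image in `X` of the agreement locus inside `U ⊓ U'`.
  refine G.sectionTriple.germ_eq_of_res
    (W := ⟨_, (U ⊓ U').isOpenEmbedding'.isOpenMap _ h⟩) ⟨⟨x, hx, hx'⟩, e, rfl⟩ ?_ ?_ ?_
  · rintro _ ⟨y, -, rfl⟩
    exact y.2.1
  · rintro _ ⟨y, -, rfl⟩
    exact y.2.2
  · refine Section.ext_fun ?_
    rintro ⟨_, y, hy, rfl⟩
    refine (Section.toFun_res _ f _).trans (Eq.trans ?_ (Section.toFun_res _ g _).symm)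
    exact hy

/-- A local inverse of `s` near `g`, cut down to the open set of points that it sends into `t⁻¹(V)`.
-/
theorem exists_section_through (g : G.1.Arr) (V : Opens X) (hV : G.1.t g ∈ V) :
    ∃ (U : Opens X) (f : G.Section U V) (h : G.1.s g ∈ U), f.toFun ⟨_, h⟩ = g := by
  obtain ⟨e, he, hs⟩ := G.2.isLocalHomeomorph_s g
  have hV' : IsOpen (G.1.t ⁻¹' V) := V.2.preimage G.2.isLocalHomeomorph_t.continuous
  have hg : e.symm (G.1.s g) = g := by
    rw [hs]
    exact e.left_inv he
  refine ⟨⟨_, e.isOpen_inter_preimage_symm hV'⟩,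
    ⟨fun x => e.symm x, ?_, fun x => ?_, fun x => x.2.2⟩, ⟨?_, ?_⟩, hg⟩
  · exact continuousOn_iff_continuous_domRestrict.1
      (e.symm.continuousOn.mono fun x hx => hx.1)
  · rw [hs]
    exact e.right_inv x.2.1
  · rw [hs]
    exact e.map_source he
  · change G.1.t (e.symm (G.1.s g)) ∈ V
    rwa [hg]

theorem exists_evalGerm_eq {x : X} (g : G.1.Arr) (hg : G.1.s g = x) (V : Opens X)
    (hV : G.1.t g ∈ V) : ∃ α : G.sectionTriple.Germ x V, evalGerm α = g := by
  subst hg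
  obtain ⟨U, f, h, e⟩ := exists_section_through g V hV
  exact ⟨G.sectionTriple.germ f _ h, e⟩

theorem evalGerm_postcomp_incl {x : X} {V W : Opens X} (h : V ≤ W)
    (α : G.sectionTriple.Germ x V) :
    evalGerm (G.sectionTriple.postcomp (G.sectionTriple.incl h) α) = evalGerm α := by
  obtain ⟨U, hx, f, rfl⟩ := α.exists_rep
  exact Section.toFun_incl_comp h f ⟨x, hx⟩

/-- Under evaluation, `C_x(V)` and `C_x(X)` become sets of arrows with source `x`, and the natural
map between them becomes an inclusion. -/
theorem germCondition_sectionTriple (G : EtaleGroupoid X) : G.sectionTriple.GermCondition := by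
  refine fun x V => ⟨fun α _ => ?_, fun α _ β _ e => ?_, fun β hβ => ?_⟩
  · have h := val_mem α
    rwa [← G.sectionTriple.val_postcomp_incl le_top α] at h
  · have e' := congrArg evalGerm e
    simp only [evalGerm_postcomp_incl] at e'
    exact evalGerm_injective e'
  · obtain ⟨α, h⟩ := exists_evalGerm_eq (evalGerm β) (s_evalGerm β) V
      ((t_evalGerm β).symm ▸ hβ)
    exact ⟨α, trivial, evalGerm_injective ((evalGerm_postcomp_incl le_top α).trans h)⟩

theorem evalGerm_germComp (hG : G.sectionTriple.GermCondition) {x y : X}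
    (β : G.sectionTriple.Germ y ⊤) (α : G.sectionTriple.Germ x ⊤) (h : α.val = y) :
    evalGerm (germComp hG β α h) = G.1.comp (evalGerm β) (evalGerm α)
      ((s_evalGerm β).trans (h.symm.trans (t_evalGerm α).symm)) := by
  obtain ⟨V, hV, g, rfl⟩ := β.exists_rep
  obtain ⟨U, hx, f, rfl⟩ := exists_rep_into hG α V (h ▸ hV)
  rw [germComp_germ]
  refine G.1.comp_congr (congrArg (Section.toFun g) (Subtype.ext ?_))
    (Section.toFun_incl_comp le_top f ⟨x, hx⟩).symm _ _
  exact (val_comp_incl (C := G.sectionTriple) f hx).symm.trans h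

/-- The inverse is the germ of a section through the inverse arrow. -/
theorem isGroupoid_star (G : EtaleGroupoid X) :
    IsGroupoid (Star (germCondition_sectionTriple G)) where
  all_isIso {x y} α := by
    obtain ⟨β, hβ⟩ := exists_evalGerm_eq (x := y.pt) (G.1.inv (evalGerm α.1))
      ((G.1.s_inv _).trans ((t_evalGerm α.1).trans α.2)) ⊤ trivial
    have hv : β.val = x.pt := by
      rw [← t_evalGerm, hβ, G.1.t_inv, s_evalGerm]
    refine ⟨⟨β, hv⟩, Subtype.ext (evalGerm_injective ?_), Subtype.ext (evalGerm_injective ?_)⟩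
    · refine (evalGerm_germComp _ β α.1 α.2).trans ?_
      refine (G.1.comp_congr hβ rfl _ (G.1.s_inv _)).trans ((G.1.inv_comp _).trans ?_)
      exact congrArg G.1.i (s_evalGerm _)
    · refine (evalGerm_germComp _ α.1 β hv).trans ?_
      refine (G.1.comp_congr rfl hβ _ (G.1.t_inv _).symm).trans ((G.1.comp_inv _).trans ?_)
      exact congrArg G.1.i ((t_evalGerm _).trans α.2)

theorem isSheaf_presheaf_sectionTriple (G : EtaleGroupoid X) (V : Opens X) :
    (G.sectionTriple.presheaf V).IsSheaf := by
  refine TopCat.Presheaf.isSheaf_of_isSheafUniqueGluing_types _ fun ι U sf hsf => ?_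
  let sf' : ∀ i, G.Section (U i) V := sf
  have hc : ∀ (i j : ι) (x : X) (hi : x ∈ U i) (hj : x ∈ U j),
      (sf' i).toFun ⟨x, hi⟩ = (sf' j).toFun ⟨x, hj⟩ := fun i j x hi hj => by
    have e := congrArg (fun f : G.Section (U i ⊓ U j) V => f.toFun ⟨x, hi, hj⟩) (hsf i j)
    exact (Section.toFun_res inf_le_left (sf' i) _).symm.trans
      (e.trans (Section.toFun_res inf_le_right (sf' j) _))
  -- Pick at each point some member of the cover; by compatibility the value there does not depend
  -- on the choice.
  choose k hk using fun x : ↥(iSup U) => Opens.mem_iSup.1 x.2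
  have hres : ∀ (i : ι) (x : ↥(iSup U)) (hi : (x : X) ∈ U i),
      (sf' (k x)).toFun ⟨x, hk x⟩ = (sf' i).toFun ⟨x, hi⟩ := fun i x hi => hc _ _ _ _ _
  let s : G.Section (iSup U) V :=
    { toFun := fun x => (sf' (k x)).toFun ⟨x, hk x⟩
      continuous_toFun := by
        refine continuous_iff_continuousAt.2 fun x => ?_
        -- Continuity at `x` may be tested on the open set `U (k x)`, where the glued map is the
        -- single section `sf' (k x)`.
        have ho : Topology.IsOpenEmbedding (Set.inclusion (le_iSup U (k x))) :=
          Opens.isOpenEmbedding_of_le (le_iSup U (k x))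
        refine (ho.continuousAt_iff (x := ⟨x, hk x⟩)).1 ?_
        refine ((sf' (k x)).continuous_toFun.congr fun y => ?_).continuousAt
        exact (hres (k x) (Set.inclusion (le_iSup U (k x)) y) y.2).symm
      s_toFun := fun x => (sf' (k x)).s_toFun _
      t_mem := fun x => (sf' (k x)).t_mem _ }
  refine ⟨s, fun i => Section.ext_fun fun x => ?_, fun s' hs' => Section.ext_fun fun x => ?_⟩
  · exact (Section.toFun_res (le_iSup U i) s x).trans (hres i _ x.2)
  · have e := congrArg (fun f : G.Section (U (k x)) V => f.toFun ⟨x, hk x⟩) (hs' (k x))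
    exact (Section.toFun_res (le_iSup U (k x)) s' ⟨x, hk x⟩).symm.trans e

theorem isPseudogroupSheaf_sectionTriple (G : EtaleGroupoid X) :
    G.sectionTriple.IsPseudogroupSheaf where
  germCondition := germCondition_sectionTriple G
  isGroupoid := isGroupoid_star G
  isSheaf := isSheaf_presheaf_sectionTriple G

/-- The pseudogroup sheaf of sections of an étale groupoid. -/
def sectionSheaf (G : EtaleGroupoid X) : PseudogroupSheaf X :=
  ⟨G.sectionTriple, isPseudogroupSheaf_sectionTriple G⟩

/-- Composed with `germSection f`, evaluation is the continuous map `f` itself. -/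
theorem continuous_evalGerm :
    Continuous fun e : G.sectionSheaf.EtaleSpace => evalGerm e.2 :=
  PseudogroupSheaf.continuous_of_comp_germSection fun _ f => Section.continuous_toFun f

theorem bijective_evalGerm :
    Function.Bijective fun e : G.sectionSheaf.EtaleSpace => evalGerm e.2 := by
  refine ⟨?_, fun g => ?_⟩
  · rintro ⟨x, α⟩ ⟨y, β⟩ (e : evalGerm α = evalGerm β)
    obtain rfl : x = y := (s_evalGerm α).symm.trans ((congrArg G.1.s e).trans (s_evalGerm β))
    rw [evalGerm_injective e]
  · obtain ⟨α, h⟩ := exists_evalGerm_eq g rfl ⊤ trivial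
    exact ⟨⟨_, α⟩, h⟩

/-- Following evaluation by `s` gives the source map of the étale space, and the local homeomorphism
`s` can be cancelled. This provides continuity of the inverse of evaluation. -/
theorem isLocalHomeomorph_evalGerm :
    IsLocalHomeomorph fun e : G.sectionSheaf.EtaleSpace => evalGerm e.2 := by
  have h : IsLocalHomeomorph (G.1.s ∘ fun e : G.sectionSheaf.EtaleSpace => evalGerm e.2) := by
    convert PseudogroupSheaf.isLocalHomeomorph_source (C := G.sectionSheaf) using 1
    exact funext fun e => s_evalGerm e.2
  exact h.of_comp G.2.isLocalHomeomorph_s continuous_evalGerm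

/-- An étale groupoid is the groupoid of germs of its sections. -/
noncomputable def germGroupoidSectionSheafIso (G : EtaleGroupoid X) :
    GroupoidOver.Iso G.sectionSheaf.germGroupoid G.1 where
  homeo := isLocalHomeomorph_evalGerm.toHomeomorphOfBijective bijective_evalGerm
  s_map e := s_evalGerm e.2
  t_map e := t_evalGerm e.2
  map_comp g f h := evalGerm_germComp _ g.2 f.2 h.symm

/-- The isomorphism of pseudogroup sheaves of sections induced by an isomorphism of étale
groupoids. -/
def sectionTripleIso {G H : EtaleGroupoid X} (φ : GroupoidOver.Iso G.1 H.1) :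
    PseudogroupTriple.Iso G.sectionTriple H.sectionTriple where
  homEquiv {U V} :=
    { toFun := fun (f : G.Section U V) => (
        { toFun := fun x => φ.homeo (f.toFun x)
          continuous_toFun := φ.homeo.continuous.comp f.continuous_toFun
          s_toFun := fun x => (φ.s_map _).trans (f.s_toFun x)
          t_mem := fun x => (φ.t_map _).symm ▸ f.t_mem x } : H.Section U V)
      invFun := fun (f : H.Section U V) => (
        { toFun := fun x => φ.homeo.symm (f.toFun x)
          continuous_toFun := φ.homeo.symm.continuous.comp f.continuous_toFun
          s_toFun := fun x => by
            rw [← φ.s_map, Homeomorph.apply_symm_apply]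
            exact f.s_toFun x
          t_mem := fun x => by
            rw [← φ.t_map, Homeomorph.apply_symm_apply]
            exact f.t_mem x } : G.Section U V)
      left_inv := fun f => Section.ext_fun fun x => φ.homeo.symm_apply_apply _
      right_inv := fun f => Section.ext_fun fun x => φ.homeo.apply_symm_apply _ }
  map_comp g f := Section.ext_fun fun x => by
    refine (φ.map_comp _ _ _).trans (H.1.comp_congr ?_ rfl _ _)
    exact congrArg (fun y => φ.homeo (Section.toFun g y)) (Subtype.ext (φ.t_map _).symm)
  map_incl h := Section.ext_fun fun x => φ.map_i x
  under_map f := LocHomeo.ext (funext fun x => Subtype.ext (φ.t_map _))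

end EtaleGroupoid

/-! ### Recovering a pseudogroup sheaf from its germs -/

namespace PseudogroupSheaf

open PseudogroupTriple

variable {X : Type u} [TopologicalSpace X] (C : PseudogroupSheaf X)

/-- The étale groupoid of germs of a pseudogroup sheaf. -/
noncomputable def germEtaleGroupoid : EtaleGroupoid X :=
  ⟨C.germGroupoid, C.isEtale_germGroupoid⟩

variable {C}

/-- Equal germs give equality on a cover, and the sheaf `C(-, V)` is separated. -/
theorem hom_ext {U V : Opens X} {f g : C.1.Hom U V}
    (h : ∀ (x : X) (hx : x ∈ U), C.1.germ f x hx = C.1.germ g x hx) : f = g := by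
  choose W hW k k' e using fun x : U => C.1.germ_eq_iff.1 (h x x.2)
  refine TopCat.Sheaf.eq_of_locally_eq' (X := TopCat.of X)
    (⟨C.1.presheaf V, C.2.isSheaf V⟩ : TopCat.Sheaf (Type u) (TopCat.of X)) W U
    (fun x => homOfLE (k x)) (fun x hx => Opens.mem_iSup.2 ⟨⟨x, hx⟩, hW _⟩) f g fun x => e x

/-- The section of `C⋆` given by a morphism of `C`. -/
noncomputable def toSection {U V : Opens X} (f : C.1.Hom U V) :
    C.germEtaleGroupoid.Section U V where
  toFun := C.germSection (C.1.comp (C.1.incl le_top) f)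
  continuous_toFun := continuous_germSection _
  s_toFun _ := rfl
  t_mem x := by
    change (C.1.germ (C.1.comp (C.1.incl le_top) f) x x.2).val ∈ V
    rw [val_comp_incl]
    exact Subtype.property _

/-- The values of `toSection` are germs in `C_x(X)`; the injectivity half of the germ condition
brings the equality back to `C_x(V)`. -/
theorem germ_eq_of_toSection_eq {U U' V : Opens X} {f : C.1.Hom U V} {g : C.1.Hom U' V} {x : X}
    {hx : x ∈ U} {hx' : x ∈ U'} (e : (toSection f).toFun ⟨x, hx⟩ = (toSection g).toFun ⟨x, hx'⟩) :
    C.1.germ f x hx = C.1.germ g x hx' :=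
  (C.2.germCondition x V).injOn (Set.mem_univ _) (Set.mem_univ _) (eq_of_heq (Sigma.mk.inj e).2)

theorem toSection_res {U U' V : Opens X} (h : U' ≤ U) (f : C.1.Hom U V) (x : U') :
    (toSection (C.1.res h f)).toFun x = (toSection f).toFun ⟨x, h x.2⟩ := by
  refine Eq.trans ?_ (germSection_res (C.1.comp (C.1.incl le_top) f) h x)
  rw [C.1.comp_res]
  rfl

theorem toSection_injective {U V : Opens X} :
    Function.Injective (toSection : C.1.Hom U V → C.germEtaleGroupoid.Section U V) :=
  fun _ _ e => hom_ext fun x hx => germ_eq_of_toSection_eq (congrArg (·.toFun ⟨x, hx⟩) e)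

/-- The arrow `σ(x)` has target in `V`, so it is the germ of some `f` with values in `V`. The
sections `σ` and `toSection f` of the source map agree at `x`, hence near `x`. -/
theorem exists_toSection_eq_nhds {U V : Opens X} (σ : C.germEtaleGroupoid.Section U V) (x : U) :
    ∃ (W : Opens X) (h : W ≤ U) (f : C.1.Hom W V), (x : X) ∈ W ∧
      ∀ y : W, (toSection f).toFun y = σ.toFun ⟨y, h y.2⟩ := by
  obtain ⟨U', f, ⟨y, hy⟩, e⟩ := exists_germSection_eq_into (σ.toFun x) V (σ.t_mem x)
  obtain ⟨x, hx⟩ := x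
  obtain rfl : y = x := (congrArg Sigma.fst e).trans (σ.s_toFun ⟨x, hx⟩)
  have hσ := σ.continuous_toFun.comp (continuous_inclusion (inf_le_left : U ⊓ U' ≤ U))
  have hf := (toSection f).continuous_toFun.comp
    (continuous_inclusion (inf_le_right : U ⊓ U' ≤ U'))
  have h := isLocalHomeomorph_source.isLocallyInjective.isOpen_eqLocus hf hσ
    (funext fun z => (σ.s_toFun (Set.inclusion (inf_le_left : U ⊓ U' ≤ U) z)).symm)
  refine ⟨⟨_, (U ⊓ U').isOpenEmbedding'.isOpenMap _ h⟩, ?_, C.1.res ?_ f,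
    ⟨⟨y, hx, hy⟩, e, rfl⟩, ?_⟩
  · rintro _ ⟨z, -, rfl⟩
    exact z.2.1
  · rintro _ ⟨z, -, rfl⟩
    exact z.2.2
  · rintro ⟨_, z, hz, rfl⟩
    rw [toSection_res]
    exact hz

theorem toSection_surjective {U V : Opens X} :
    Function.Surjective (toSection : C.1.Hom U V → C.germEtaleGroupoid.Section U V) := by
  intro σ
  choose W h f hW hf using exists_toSection_eq_nhds σ
  obtain ⟨g, hg, -⟩ := TopCat.Sheaf.existsUnique_gluing' (X := TopCat.of X)
    (⟨C.1.presheaf V, C.2.isSheaf V⟩ : TopCat.Sheaf (Type u) (TopCat.of X)) W U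
    (fun x => homOfLE (h x)) (fun x hx => Opens.mem_iSup.2 ⟨⟨x, hx⟩, hW _⟩) f fun x y => by
      -- On overlaps both local morphisms have the germs prescribed by `σ`, so they coincide.
      refine hom_ext fun z hz => germ_eq_of_toSection_eq ?_
      refine (toSection_res inf_le_left (f x) ⟨z, hz⟩).trans (((hf x ⟨z, hz.1⟩).trans
        (hf y ⟨z, hz.2⟩).symm).trans (toSection_res inf_le_right (f y) ⟨z, hz⟩).symm)
  refine ⟨g, EtaleGroupoid.Section.ext_fun fun x => ?_⟩
  have e := congrArg (fun k : C.1.Hom (W x) V => (toSection k).toFun ⟨x, hW x⟩) (hg x)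
  exact (toSection_res (h x) g ⟨x, hW x⟩).symm.trans (e.trans (hf x ⟨x, hW x⟩))

/-- A pseudogroup sheaf is the pseudogroup sheaf of sections of its groupoid of germs. -/
noncomputable def isoSectionTriple (C : PseudogroupSheaf X) :
    PseudogroupTriple.Iso C.1 C.germEtaleGroupoid.sectionTriple where
  homEquiv := Equiv.ofBijective toSection ⟨toSection_injective, toSection_surjective⟩
  map_comp {U V W} g f := EtaleGroupoid.Section.ext_fun fun x => by
    have hv := val_comp_incl (C := C.1) f x.2
    refine congrArg (Sigma.mk (x : X)) ?_
    rw [← C.1.assoc]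
    exact (germComp_germ C.2.germCondition (C.1.comp (C.1.incl le_top) g) f x.2 _ rfl).symm
  map_incl {U V} h := EtaleGroupoid.Section.ext_fun fun x => by
    refine congrArg (Sigma.mk (x : X)) (C.1.germ_eq_of_res (W := U) x.2 le_rfl le_top ?_)
    rw [C.1.res_self, ← C.1.incl_trans, res, C.1.id_comp]
  under_map f := LocHomeo.ext (funext fun x => Subtype.ext (val_comp_incl f x.2))

end PseudogroupSheaf

/-! ### Functoriality of germs under isomorphisms -/

namespace PseudogroupTriple.Iso

variable {X : Type u} [TopologicalSpace X] {C D : PseudogroupTriple X}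

theorem map_res (φ : Iso C D) {U U' V : Opens X} (h : U' ≤ U) (f : C.Hom U V) :
    φ.homEquiv (C.res h f) = D.res h (φ.homEquiv f) := by
  rw [res, φ.map_comp, φ.map_incl]
  rfl

/-- The map on stalks induced by an isomorphism of triples. -/
def mapGerm (φ : Iso C D) {x : X} {V : Opens X} (α : C.Germ x V) : D.Germ x V :=
  Quotient.lift (s := C.germSetoid x V) (fun p => D.germ (φ.homEquiv p.hom) x p.mem)
    (fun p q ⟨W, hx, h, k, e⟩ => D.germ_eq_of_res hx h k (by
      rw [← φ.map_res, ← φ.map_res, e])) α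

theorem mapGerm_germ (φ : Iso C D) {x : X} {U V : Opens X} (f : C.Hom U V) (hx : x ∈ U) :
    φ.mapGerm (C.germ f x hx) = D.germ (φ.homEquiv f) x hx := rfl

theorem val_mapGerm (φ : Iso C D) {x : X} {V : Opens X} (α : C.Germ x V) :
    (φ.mapGerm α).val = α.val := by
  obtain ⟨U, hx, f, rfl⟩ := α.exists_rep
  rw [mapGerm_germ, val_germ, val_germ, φ.under_map]

theorem mapGerm_germComp (φ : Iso C D) (hC : C.GermCondition) (hD : D.GermCondition) {x y : X}
    (β : C.Germ y ⊤) (α : C.Germ x ⊤) (h : α.val = y) (h' : (φ.mapGerm α).val = y) :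
    φ.mapGerm (germComp hC β α h) = germComp hD (φ.mapGerm β) (φ.mapGerm α) h' := by
  obtain ⟨V, hV, g, rfl⟩ := β.exists_rep
  obtain ⟨U, hx, f, rfl⟩ := exists_rep_into hC α V (h ▸ hV)
  -- As `φ` respects `le_top` inclusions, the image of `α` still has a representative with values in
  -- `V`, so the composite can be computed on representatives.
  have key : ∀ (γ : D.Germ x ⊤) (hγ : γ.val = y),
      γ = D.germ (D.comp (D.incl le_top) (φ.homEquiv f)) x hx →
      germComp hD (D.germ (φ.homEquiv g) y hV) γ hγ =
        D.germ (D.comp (φ.homEquiv g) (φ.homEquiv f)) x hx := by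
    rintro γ hγ rfl
    exact germComp_germ hD _ _ _ _ _
  rw [germComp_germ, mapGerm_germ, mapGerm_germ, φ.map_comp, key]
  rw [mapGerm_germ, φ.map_comp, φ.map_incl]

/-- The inverse of an isomorphism of triples. -/
def symm (φ : Iso C D) : Iso D C where
  homEquiv := φ.homEquiv.symm
  map_comp g f := by
    rw [Equiv.symm_apply_eq, φ.map_comp, Equiv.apply_symm_apply, Equiv.apply_symm_apply]
  map_incl h := by rw [Equiv.symm_apply_eq, φ.map_incl]
  under_map f := by rw [← φ.under_map, Equiv.apply_symm_apply]

theorem symm_mapGerm_mapGerm (φ : Iso C D) {x : X} {V : Opens X} (α : C.Germ x V) :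
    φ.symm.mapGerm (φ.mapGerm α) = α := by
  obtain ⟨U, hx, f, rfl⟩ := α.exists_rep
  exact congrArg (C.germ · x hx) (φ.homEquiv.symm_apply_apply f)

end PseudogroupTriple.Iso

namespace PseudogroupSheaf

open PseudogroupTriple

variable {X : Type u} [TopologicalSpace X] {C D : PseudogroupSheaf X}

/-- The map of étale spaces induced by an isomorphism of pseudogroup sheaves. -/
def mapEtaleSpace (φ : PseudogroupTriple.Iso C.1 D.1) (e : C.EtaleSpace) : D.EtaleSpace :=
  ⟨e.1, φ.mapGerm e.2⟩

/-- The map carries the section of germs of `f` to that of `φ.homEquiv f`. -/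
theorem continuous_mapEtaleSpace (φ : PseudogroupTriple.Iso C.1 D.1) :
    Continuous (mapEtaleSpace φ) :=
  continuous_of_comp_germSection fun _ f => continuous_germSection (φ.homEquiv f)

/-- The isomorphism of groupoids of germs induced by an isomorphism of pseudogroup sheaves. -/
noncomputable def germGroupoidIso (φ : PseudogroupTriple.Iso C.1 D.1) :
    GroupoidOver.Iso C.germGroupoid D.germGroupoid where
  homeo :=
    { toFun := mapEtaleSpace φ
      invFun := mapEtaleSpace (C := D) (D := C) φ.symm
      left_inv := fun e => congrArg (Sigma.mk e.1) (φ.symm_mapGerm_mapGerm e.2)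
      right_inv := fun e => congrArg (Sigma.mk e.1) (φ.symm.symm_mapGerm_mapGerm e.2)
      continuous_toFun := continuous_mapEtaleSpace φ
      continuous_invFun := continuous_mapEtaleSpace (C := D) (D := C) φ.symm }
  s_map _ := rfl
  t_map e := φ.val_mapGerm e.2
  map_comp g f h := congrArg (Sigma.mk f.1) (φ.mapGerm_germComp C.2.germCondition
    D.2.germCondition g.2 f.2 h.symm ((φ.val_mapGerm f.2).trans h.symm))

end PseudogroupSheaf

theorem mainTheorem8 (X : Type u) [TopologicalSpace X] :
    ∃ (hS : ∀ G : EtaleGroupoid X, G.sectionTriple.IsPseudogroupSheaf)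
      (hT : ∀ C : PseudogroupSheaf X, C.germGroupoid.IsEtale)
      (e : Quotient (EtaleGroupoid.isoSetoid X) ≃ Quotient (PseudogroupSheaf.isoSetoid X)),
      (∀ G : EtaleGroupoid X,
        e (Quotient.mk (EtaleGroupoid.isoSetoid X) G) =
          Quotient.mk (PseudogroupSheaf.isoSetoid X) ⟨G.sectionTriple, hS G⟩) ∧
      (∀ C : PseudogroupSheaf X,
        e.symm (Quotient.mk (PseudogroupSheaf.isoSetoid X) C) =
          Quotient.mk (EtaleGroupoid.isoSetoid X) ⟨C.germGroupoid, hT C⟩) := by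
  refine ⟨EtaleGroupoid.isPseudogroupSheaf_sectionTriple, PseudogroupSheaf.isEtale_germGroupoid,
    { toFun := Quotient.map (sa := EtaleGroupoid.isoSetoid X)
        (sb := PseudogroupSheaf.isoSetoid X) EtaleGroupoid.sectionSheaf
        fun _ _ ⟨φ⟩ => ⟨EtaleGroupoid.sectionTripleIso φ⟩
      invFun := Quotient.map (sa := PseudogroupSheaf.isoSetoid X)
        (sb := EtaleGroupoid.isoSetoid X) PseudogroupSheaf.germEtaleGroupoid
        fun _ _ ⟨φ⟩ => ⟨PseudogroupSheaf.germGroupoidIso φ⟩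
      left_inv := ?_
      right_inv := ?_ }, fun _ => rfl, fun _ => rfl⟩
  · rintro ⟨G⟩
    exact Quotient.sound (s := EtaleGroupoid.isoSetoid X) ⟨G.germGroupoidSectionSheafIso⟩
  · rintro ⟨C⟩
    exact Quotient.sound (s := PseudogroupSheaf.isoSetoid X)
      ((PseudogroupSheaf.isoSetoid X).symm ⟨C.isoSectionTriple⟩)
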